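/- Let $\Omega$ be a set and, for every $i\in\Omega$, let $\mathcal S_i\subseteq[0,\infty)$ be an additive subsemigroup containing $0$ that is commensurable: for any $s_1,\dots,s_N\in\mathcal S_i$ there are $s_0\in\mathcal S_i$ and $a_1,\dots,a_N\in\mathbb N=\{0,1,2,\dots\}$ with $s_k=a_ks_0$ for all $k$. Let $\mathcal S$ be the additive semigroup of all finitely supported $s:\Omega\to[0,\infty)$ with $s(j)\in\mathcal S_j$ for all $j$, let $\mathcal S-\mathcal S$ be the subgroup of $\mathbb R^\Omega$ generated by $\mathcal S$, and for $s\in\mathcal S-\mathcal S$ let $s_+=\max(s,0)$ and $s_-=s_+-s$ (pointwise); these belong to $\mathcal S$. Write $\mathbf e_i(a)$ for the function with value $a$ at $i$ and $0$ elsewhere. A semigroup over $\mathcal S$ on a complex Hilbert space $H$ is a family $T=\{T_s\}_{s\in\mathcal S}$ of bounded operators on $H$ with $T_0=I$ and $T_{s+t}=T_sT_t$. It doubly commutes if $$T_{\mathbf e_j(b)}T_{\mathbf e_i(a)}^*=T_{\mathbf e_i(a)}^*T_{\mathbf e_j(b)}\qquad\text{for all } i\ne j,\ a\in\mathcal S_i,\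 b\in\mathcal S_j.$$ For a semigroup $T$ of contractions over $\mathcal S$ on $H$, a regular unitary (respectively isometric) dilation of $T$ is a semigroup $U=\{U_s\}_{s\in\mathcal S}$ of unitaries (respectively isometries) on a Hilbert space $K\supseteq H$ such that $$P_HU_{s_-}^*U_{s_+}\big|_H=T_{s_-}^*T_{s_+}\qquad\text{for all } s\in\mathcal S-\mathcal S .$$ A regular unitary dilation is minimal if $K=\bigvee_{s\in\mathcal S-\mathcal S}U_{s_-}^*U_{s_+}H$; a regular isometric dilation is minimal if $K=\bigvee_{s\in\mathcal S}U_sH$ (closed linear spans). Let $T$ be a doubly commuting semigroup of contractions over $\mathcal S$ on a complex Hilbert space $H$. Then: (1) $T$ has a minimal regular unitary dilation that doubly commutes, and it is unique: for any minimal regular unitary dilation $U'$ of $T$ on $K'\supseteq H$ there is a unitary $W:K\to K'$ with $Wh=h$ for $h\in H$ and $WU_s=U'_sW$ for $s\in\mathcal S$. (2) $T$ has a minimal regular isometric dilation that doubly commutes, and it is unique in the same sense among all minimal regular isometric dilations of $T$. -/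

import Mathlib

universe u v w

/-- A commensurable (additive) semigroup: any finitely many elements are natural multiples
(`0` allowed) of one element. -/
def IsCommensurable (M : Type*) [AddMonoid M] : Prop :=
  ∀ (N : ℕ) (s : Fin N → M), ∃ (s₀ : M) (a : Fin N → ℕ), ∀ i, s i = a i • s₀

/-- A subsemigroup `S` of `ℝ^Ω` is `+,-`-closed if `s₊ = max(s,0)` and `s₋ = s₊ - s = max(-s,0)`
(pointwise) belong to `S` for every `s` in the group `S - S` generated by `S`. -/
def PosNegClosed {Ω : Type*} (S : AddSubmonoid (Ω → ℝ)) : Prop :=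
  ∀ s ∈ AddSubgroup.closure (S : Set (Ω → ℝ)), s⁺ ∈ S ∧ s⁻ ∈ S

/-- The semigroup `∑ i, 𝒮 i` of finitely supported functions `s` on `Ω` with `s j ∈ 𝒮 j`. -/
def sumSemigroup {Ω : Type*} (𝒮 : Ω → AddSubmonoid ℝ) : AddSubmonoid (Ω → ℝ) where
  carrier := {s | (Function.support s).Finite ∧ ∀ j, s j ∈ 𝒮 j}
  zero_mem' := ⟨by simp, fun j => (𝒮 j).zero_mem⟩
  add_mem' := fun ha hb =>
    ⟨(ha.1.union hb.1).subset (Function.support_add _ _), fun j => (𝒮 j).add_mem (ha.2 j) (hb.2 j)⟩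

open Classical in
/-- The inclusion `e_j` of `𝒮 j` into `∑ i, 𝒮 i`. -/
noncomputable def sumSemigroup.incl {Ω : Type*} (𝒮 : Ω → AddSubmonoid ℝ) (j : Ω) (x : 𝒮 j) :
    sumSemigroup 𝒮 :=
  ⟨Pi.single j (x : ℝ), by
    refine ⟨(Set.finite_singleton j).subset Pi.support_single_subset, fun k => ?_⟩
    by_cases h : k = j
    · subst h
      simp
    · simp [Pi.single_eq_of_ne h]⟩

theorem IsCommensurable.max_sub_mem {A : AddSubmonoid ℝ} (hA : IsCommensurable A)
    (hpos : ∀ x ∈ A, 0 ≤ x) {a b : ℝ} (ha : a ∈ A) (hb : b ∈ A) : max (a - b) 0 ∈ A := by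
  obtain ⟨s₀, c, hc⟩ := hA 2 ![⟨a, ha⟩, ⟨b, hb⟩]
  have h0 := congrArg Subtype.val (hc 0)
  have h1 := congrArg Subtype.val (hc 1)
  simp only [Matrix.cons_val_zero, Matrix.cons_val_one, AddSubmonoidClass.coe_nsmul] at h0 h1
  have hs := hpos s₀ s₀.2
  rw [h0, h1]
  rcases le_total (c 1) (c 0) with h | h
  · have e : c 0 • (s₀ : ℝ) - c 1 • (s₀ : ℝ) = (c 0 - c 1) • (s₀ : ℝ) := by
      rw [sub_eq_iff_eq_add, ← add_nsmul, Nat.sub_add_cancel h]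
    rw [e, max_eq_left (nsmul_nonneg hs _)]
    exact A.nsmul_mem s₀.2 _
  · rw [max_eq_right (sub_nonpos.2 (nsmul_le_nsmul_left hs h))]
    exact A.zero_mem

theorem sumSemigroup_posNegClosed {Ω : Type*} {𝒮 : Ω → AddSubmonoid ℝ}
    (hpos : ∀ i, ∀ x ∈ 𝒮 i, 0 ≤ x) (hcomm : ∀ i, IsCommensurable (𝒮 i)) :
    PosNegClosed (sumSemigroup 𝒮) := by
  have key : ∀ a ∈ sumSemigroup 𝒮, ∀ b ∈ sumSemigroup 𝒮, (a - b)⁺ ∈ sumSemigroup 𝒮 := by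
    intro a ha b hb
    refine ⟨(ha.1.union hb.1).subset fun j hj => ?_,
      fun j => (hcomm j).max_sub_mem (hpos j) (ha.2 j) (hb.2 j)⟩
    by_contra h
    simp only [Set.mem_union, Function.mem_support, not_or, not_not] at h
    exact hj (by simp [Pi.posPart_apply, h.1, h.2])
  intro s hs
  obtain ⟨a, ha, b, hb, rfl⟩ : ∃ a ∈ sumSemigroup 𝒮, ∃ b ∈ sumSemigroup 𝒮, s = a - b := by
    induction hs using AddSubgroup.closure_induction with
    | mem x hx => exact ⟨x, hx, 0, zero_mem _, by simp⟩
    | zero => exact ⟨0, zero_mem _, 0, zero_mem _, by simp⟩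
    | add x y _ _ hx hy =>
      obtain ⟨a, ha, b, hb, rfl⟩ := hx
      obtain ⟨c, hc, d, hd, rfl⟩ := hy
      exact ⟨a + c, add_mem ha hc, b + d, add_mem hb hd, by abel⟩
    | neg x _ hx =>
      obtain ⟨a, ha, b, hb, rfl⟩ := hx
      exact ⟨b, hb, a, ha, by abel⟩
  refine ⟨key a ha b hb, ?_⟩
  rw [← posPart_neg, neg_sub]
  exact key b hb a ha

section Semigroups

variable {Ω : Type*} {S : AddSubmonoid (Ω → ℝ)}
variable {H : Type*} [NormedAddCommGroup H] [InnerProductSpace ℂ H]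
variable {K : Type*} [NormedAddCommGroup K] [InnerProductSpace ℂ K]

/-- `T` is a semigroup of bounded operators over `S`. -/
structure IsOpSemigroup (T : S → (H →L[ℂ] H)) : Prop where
  map_zero : T 0 = 1
  map_add : ∀ s t, T (s + t) = T s * T t

/-- `T` is a semigroup of contractions over `S`. -/
structure IsContractiveSemigroup (T : S → (H →L[ℂ] H)) : Prop extends IsOpSemigroup T where
  norm_le_one : ∀ s, ‖T s‖ ≤ 1

/-- `T` doubly commutes: `T_{e_j(b)} T_{e_i(a)}^* = T_{e_i(a)}^* T_{e_j(b)}` whenever `i ≠ j`. -/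
def DoublyCommutes [CompleteSpace H] {𝒮 : Ω → AddSubmonoid ℝ}
    (T : sumSemigroup 𝒮 → (H →L[ℂ] H)) : Prop :=
  ∀ i j : Ω, i ≠ j → ∀ (a : 𝒮 i) (b : 𝒮 j),
    T (sumSemigroup.incl 𝒮 j b) * ContinuousLinearMap.adjoint (T (sumSemigroup.incl 𝒮 i a)) =
      ContinuousLinearMap.adjoint (T (sumSemigroup.incl 𝒮 i a)) * T (sumSemigroup.incl 𝒮 j b)

/-- The dilation `U`, extended to the group `S - S` by `U(s) = U_{s₋}^* U_{s₊}`. -/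
noncomputable def groupExtension [CompleteSpace K] (hS : PosNegClosed S) (U : S → (K →L[ℂ] K))
    (s : AddSubgroup.closure (S : Set (Ω → ℝ))) : K →L[ℂ] K :=
  ContinuousLinearMap.adjoint (U ⟨(s : Ω → ℝ)⁻, (hS s s.2).2⟩) * U ⟨(s : Ω → ℝ)⁺, (hS s s.2).1⟩

/-- `P_H U_{s₋}^* U_{s₊}|_H = T_{s₋}^* T_{s₊}` for all `s ∈ S - S`, where `H` is regarded as a
subspace of `K` through the isometric embedding `J` (so that `P_H` is the adjoint of `J`). -/
def IsRegularDilation [CompleteSpace H] [CompleteSpace K] (hS : PosNegClosed S)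
    (T : S → (H →L[ℂ] H)) (J : H →ₗᵢ[ℂ] K) (U : S → (K →L[ℂ] K)) : Prop :=
  ∀ s : AddSubgroup.closure (S : Set (Ω → ℝ)),
    ContinuousLinearMap.adjoint J.toContinuousLinearMap ∘L
        groupExtension hS U s ∘L J.toContinuousLinearMap =
      groupExtension hS T s

/-- `(K, J, U)` is a minimal regular unitary dilation of `T`: `U` is a semigroup of unitaries, it is
a regular dilation, and `K` is the closed linear span of the spaces `U(s) H`, `s ∈ S - S`. -/
structure IsMinimalRegularUnitaryDilation [CompleteSpace H] [CompleteSpace K] (hS : PosNegClosed S)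
    (T : S → (H →L[ℂ] H)) (J : H →ₗᵢ[ℂ] K) (U : S → (K →L[ℂ] K)) : Prop where
  semigroup : IsOpSemigroup U
  unitary : ∀ s, U s ∈ unitary (K →L[ℂ] K)
  regular : IsRegularDilation hS T J U
  minimal : (Submodule.span ℂ
    {x : K | ∃ s h, x = groupExtension hS U s (J h)}).topologicalClosure = ⊤

/-- `(K, J, V)` is a minimal regular isometric dilation of `T`: `V` is a semigroup of isometries, it
is a regular dilation, and `K` is the closed linear span of the spaces `V_s H`, `s ∈ S`. -/
structure IsMinimalRegularIsometricDilation [CompleteSpace H] [CompleteSpace K]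
    (hS : PosNegClosed S) (T : S → (H →L[ℂ] H)) (J : H →ₗᵢ[ℂ] K) (V : S → (K →L[ℂ] K)) :
    Prop where
  semigroup : IsOpSemigroup V
  isometry : ∀ s, Isometry (V s)
  regular : IsRegularDilation hS T J V
  minimal : (Submodule.span ℂ {x : K | ∃ s h, x = V s (J h)}).topologicalClosure = ⊤

end Semigroups

/-- `(K, J, U)` and `(K', J', U')` are unitarily equivalent by a unitary that is the identity
on `H`. -/
def DilationEquivalent {ι H K K' : Type*} [NormedAddCommGroup H] [InnerProductSpace ℂ H]
    [NormedAddCommGroup K] [InnerProductSpace ℂ K] [NormedAddCommGroup K'] [InnerProductSpace ℂ K']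
    (J : H →ₗᵢ[ℂ] K) (U : ι → (K →L[ℂ] K)) (J' : H →ₗᵢ[ℂ] K') (U' : ι → (K' →L[ℂ] K')) : Prop :=
  ∃ W : K ≃ₗᵢ[ℂ] K', (∀ h, W (J h) = J' h) ∧ ∀ s x, W (U s x) = U' s (W x)

/-! Both dilations come from one positive definite kernel, `regularSymbol T (y - x)`, the value
$T_{s_-}^*T_{s_+}$ at $s=y-x$. It is taken on the group $\mathcal S-\mathcal S$ for the unitary
dilation and on $\mathcal S$ for the isometric one.

Positivity (`regularSymbol_positive`): double commutation splits the symbol into a product of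
commuting one-coordinate symbols. For finitely many points, commensurability turns a single
coordinate into the Toeplitz matrix of one contraction $C$, which factors as $A^*A$ through the
defect operator $(1-C^*C)^{1/2}$. The entries of $A$ commute with the symbol of the other
coordinates, so coordinates can be multiplied in one at a time.

A Kolmogorov decomposition then gives operators $\Lambda_x:H\to K$ with total ranges and
$\Lambda_x^*\Lambda_y$ equal to the kernel. The kernel is translation invariant, so
$V_s\Lambda_x=\Lambda_{x+s}$ defines isometries, which are unitary when the index set is a group. In
any minimal regular dilation the operators $h\mapsto U(x)h$ (or $V_xh$) have the same Gram
operators, whence uniqueness.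

Commuting unitaries doubly commute. For isometries, $V_{\mathbf e_i(a)}^*$ first cancels what it can
of the coordinate $x_i$, and the remainder acts on $\Lambda_y$ with $y_i=0$ as $T^*$ on $H$. This
does not see the other coordinates, which are all that $V_{\mathbf e_j(b)}$ changes. -/

/-! ### Operator families determined by their Gram operators. -/

section Gram

variable {X : Type*} {V K K' : Type*}
variable [NormedAddCommGroup V] [InnerProductSpace ℂ V] [CompleteSpace V]
variable [NormedAddCommGroup K] [InnerProductSpace ℂ K] [CompleteSpace K]
variable [NormedAddCommGroup K'] [InnerProductSpace ℂ K'] [CompleteSpace K']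

open ContinuousLinearMap InnerProductSpace

theorem inner_eq_of_gram_eq {Λ : X → (V →L[ℂ] K)} {Λ' : X → (V →L[ℂ] K')}
    (h : ∀ x y, adjoint (Λ x) ∘L Λ y = adjoint (Λ' x) ∘L Λ' y) (x y : X) (v w : V) :
    inner ℂ (Λ x v) (Λ y w) = inner ℂ (Λ' x v) (Λ' y w) := by
  have := congrArg (fun A : V →L[ℂ] V => inner ℂ v (A w)) (h x y)
  simpa [adjoint_inner_right] using this

/-- Two families of operators with the same Gram operators are related by an isometry, if the
first one is total. -/
theorem exists_linearIsometry_of_gram_eq {Λ : X → (V →L[ℂ] K)} {Λ' : X → (V →L[ℂ] K')}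
    (hΛ : (Submodule.span ℂ {z : K | ∃ x v, z = Λ x v}).topologicalClosure = ⊤)
    (h : ∀ x y, adjoint (Λ x) ∘L Λ y = adjoint (Λ' x) ∘L Λ' y) :
    ∃ W : K →ₗᵢ[ℂ] K', ∀ x v, W (Λ x v) = Λ' x v := by
  classical
  let e : (X →₀ V) →ₗ[ℂ] K := Finsupp.lsum ℂ fun x => (Λ x : V →ₗ[ℂ] K)
  let f : (X →₀ V) →ₗ[ℂ] K' := Finsupp.lsum ℂ fun x => (Λ' x : V →ₗ[ℂ] K')
  have hnorm : ∀ a, ‖f a‖ = ‖e a‖ := by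
    intro a
    have hin : inner ℂ (e a) (e a) = inner ℂ (f a) (f a) := by
      simp only [e, f, Finsupp.lsum_apply, Finsupp.sum, sum_inner, inner_sum]
      exact Finset.sum_congr rfl fun x _ => Finset.sum_congr rfl fun y _ =>
        inner_eq_of_gram_eq h _ _ _ _
    rw [@norm_eq_sqrt_re_inner ℂ, @norm_eq_sqrt_re_inner ℂ, hin]
  have hdense : DenseRange e := by
    rw [← Submodule.dense_iff_topologicalClosure_eq_top] at hΛ
    refine hΛ.mono ?_
    rw [← LinearMap.coe_range, SetLike.coe_subset_coe, Submodule.span_le]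
    rintro _ ⟨x, v, rfl⟩
    exact ⟨Finsupp.single x v, by simp [e]⟩
  have hbound : ∀ a, ‖f a‖ ≤ 1 * ‖e a‖ := fun a => by rw [one_mul, hnorm]
  have hW : ∀ a, f.extendOfNorm e (e a) = f a :=
    fun a => LinearMap.extendOfNorm_eq hdense ⟨1, hbound⟩ a
  refine ⟨⟨(f.extendOfNorm e : K →ₗ[ℂ] K'), fun z => ?_⟩, fun x v => ?_⟩
  · refine hdense.induction_on z (isClosed_eq (by fun_prop) (by fun_prop)) fun a => ?_
    simp [hW, hnorm]
  · simpa [e, f] using hW (Finsupp.single x v)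

theorem exists_linearIsometryEquiv_of_gram_eq {Λ : X → (V →L[ℂ] K)} {Λ' : X → (V →L[ℂ] K')}
    (hΛ : (Submodule.span ℂ {z : K | ∃ x v, z = Λ x v}).topologicalClosure = ⊤)
    (hΛ' : (Submodule.span ℂ {z : K' | ∃ x v, z = Λ' x v}).topologicalClosure = ⊤)
    (h : ∀ x y, adjoint (Λ x) ∘L Λ y = adjoint (Λ' x) ∘L Λ' y) :
    ∃ W : K ≃ₗᵢ[ℂ] K', ∀ x v, W (Λ x v) = Λ' x v := by
  obtain ⟨W, hW⟩ := exists_linearIsometry_of_gram_eq hΛ h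
  have hsurj : Function.Surjective W := by
    rw [← Set.range_eq_univ, ← W.isometry.isClosedEmbedding.isClosed_range.closure_eq,
      ← dense_iff_closure_eq]
    rw [← Submodule.dense_iff_topologicalClosure_eq_top] at hΛ'
    refine hΛ'.mono ?_
    change _ ⊆ ((LinearMap.range W.toLinearMap : Submodule ℂ K') : Set K')
    rw [SetLike.coe_subset_coe, Submodule.span_le]
    rintro _ ⟨x, v, rfl⟩
    exact ⟨Λ x v, hW x v⟩
  exact ⟨LinearIsometryEquiv.ofSurjective W hsurj, hW⟩

end Gram

theorem ContinuousLinearMap.ext_of_total {X V K K' : Type*}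
    [NormedAddCommGroup V] [InnerProductSpace ℂ V] [NormedAddCommGroup K] [InnerProductSpace ℂ K]
    [NormedAddCommGroup K'] [InnerProductSpace ℂ K'] {Λ : X → (V →L[ℂ] K)}
    (hΛ : (Submodule.span ℂ {z : K | ∃ x v, z = Λ x v}).topologicalClosure = ⊤)
    {A B : K →L[ℂ] K'} (h : ∀ x v, A (Λ x v) = B (Λ x v)) : A = B := by
  rw [← Submodule.dense_iff_topologicalClosure_eq_top] at hΛ
  refine ContinuousLinearMap.ext_on hΛ ?_
  rintro _ ⟨x, v, rfl⟩
  exact h x v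

/-- Kolmogorov decomposition of a positive definite operator-valued kernel. -/
theorem exists_kolmogorov_decomposition {X : Type u} {V : Type v} [NormedAddCommGroup V]
    [InnerProductSpace ℂ V] [CompleteSpace V] (k : X → X → (V →L[ℂ] V))
    (hk : ∀ x y, star (k x y) = k y x)
    (hpos : ∀ f : X →₀ V, 0 ≤ (∑ x ∈ f.support, ∑ y ∈ f.support,
      inner ℂ (f x) (k x y (f y))).re) :
    ∃ (K : Type (max u v)) (_ : NormedAddCommGroup K) (_ : InnerProductSpace ℂ K)
      (_ : CompleteSpace K) (Λ : X → (V →L[ℂ] K)),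
      (∀ x y, ContinuousLinearMap.adjoint (Λ x) ∘L Λ y = k x y) ∧
      (Submodule.span ℂ {z : K | ∃ x v, z = Λ x v}).topologicalClosure = ⊤ := by
  have hP : (Matrix.of k).PosSemidef := by
    have htfae := (RKHS.posSemidef_tfae (K := Matrix.of k)).out 0 2
    refine htfae.mpr ⟨?_, fun f => ?_⟩
    · ext1 x y
      exact hk y x
    · have := hpos f
      -- Conjugation keeps the real part and swaps the two slots of each inner product.
      rw [← Complex.conj_re, map_sum] at this
      simp only [map_sum, inner_conj_symm] at this
      rw [Finset.sum_comm] at this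
      exact this
  have : Fact (Matrix.of k).PosSemidef := ⟨hP⟩
  refine ⟨RKHS.OfKernel (Matrix.of k), inferInstance, inferInstance, inferInstance,
    RKHS.kerFun _, fun x y => ?_, ?_⟩
  · rw [← RKHS.kernel_apply, RKHS.OfKernel.kernel_ofKernel]
    rfl
  · simpa only [eq_comm] using RKHS.kerFun_dense (RKHS.OfKernel (Matrix.of k))

/-! ### Restricting elements of the sum semigroup to sets of coordinates. -/

section Restriction

variable {Ω : Type*} {𝒮 : Ω → AddSubmonoid ℝ}

open Classical in
theorem sumSemigroup.single_mem {i : Ω} {a : ℝ} (ha : a ∈ 𝒮 i) :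
    Pi.single i a ∈ sumSemigroup 𝒮 :=
  (sumSemigroup.incl 𝒮 i ⟨a, ha⟩).2

theorem sumSemigroup.indicator_mem {s : Ω → ℝ} (hs : s ∈ sumSemigroup 𝒮) (F : Set Ω) :
    F.indicator s ∈ sumSemigroup 𝒮 := by
  refine ⟨hs.1.subset (by simp [Set.support_indicator]), fun j => ?_⟩
  by_cases hj : j ∈ F
  · simpa [hj] using hs.2 j
  · simp [hj]

open Classical in
theorem Set.indicator_insert_eq_single_add {F : Set Ω} {i : Ω} (hi : i ∉ F) (s : Ω → ℝ) :
    (insert i F).indicator s = Pi.single i (s i) + F.indicator s := by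
  ext j
  by_cases hj : j = i
  · subst hj
    simp [hi]
  · by_cases hF : j ∈ F <;> simp [hj, hF]

-- Coordinates are added one by one, with the values of the fixed `s`. The condition `s i ≠ 0` lets
-- disjointness of supports be used in the induction step.
open Classical in
theorem sumSemigroup.induction {p : (Ω → ℝ) → Prop} {s : Ω → ℝ} (hs : s ∈ sumSemigroup 𝒮)
    (zero : p 0)
    (single_add : ∀ i, s i ≠ 0 → ∀ t ∈ sumSemigroup 𝒮, p t → p (Pi.single i (s i) + t)) : p s := by
  have key : ∀ F : Finset Ω, (∀ i ∈ F, s i ≠ 0) → p ((F : Set Ω).indicator s) := by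
    intro F
    induction F using Finset.induction_on with
    | empty => exact fun _ => by simpa only [Finset.coe_empty, Set.indicator_empty'] using zero
    | insert i F hi ih =>
      intro h
      rw [Finset.coe_insert, Set.indicator_insert_eq_single_add (by simpa using hi)]
      exact single_add i (h i (by simp)) _ (indicator_mem hs _)
        (ih fun j hj => h j (by simp [hj]))
  have := key hs.1.toFinset (by simp)
  rwa [Set.Finite.coe_toFinset, Set.indicator_support] at this

theorem sumSemigroup.posPart_negPart_indicator_mem (hS : PosNegClosed (sumSemigroup 𝒮)) {x : Ω → ℝ}
    (hx : x ∈ AddSubgroup.closure (sumSemigroup 𝒮 : Set (Ω → ℝ)))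
    (F : Set Ω) :
    (F.indicator x)⁺ ∈ sumSemigroup 𝒮 ∧ (F.indicator x)⁻ ∈ sumSemigroup 𝒮 := by
  have h := hS x hx
  refine ⟨?_, ?_⟩
  · convert indicator_mem h.1 F using 1
    ext j
    by_cases hj : j ∈ F <;> simp [hj, Pi.posPart_apply]
  · convert indicator_mem h.2 F using 1
    ext j
    by_cases hj : j ∈ F <;> simp [hj, Pi.negPart_apply]

end Restriction

/-! ### The symbol $T_{s_-}^*T_{s_+}$. -/

section Symbol

variable {Ω : Type*} {S : AddSubmonoid (Ω → ℝ)}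
variable {H : Type*} [NormedAddCommGroup H] [InnerProductSpace ℂ H]

open Classical in
/-- The semigroup `T` as a function on `ℝ^Ω`, with value `1` outside of `S`. -/
noncomputable def extendByOne (T : S → (H →L[ℂ] H)) (s : Ω → ℝ) : H →L[ℂ] H :=
  if h : s ∈ S then T ⟨s, h⟩ else 1

theorem extendByOne_of_mem (T : S → (H →L[ℂ] H)) {s : Ω → ℝ} (hs : s ∈ S) :
    extendByOne T s = T ⟨s, hs⟩ := dif_pos hs

theorem extendByOne_coe (T : S → (H →L[ℂ] H)) (s : S) : extendByOne T s = T s :=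
  dif_pos s.2

theorem IsOpSemigroup.commute {T : S → (H →L[ℂ] H)} (hT : IsOpSemigroup T) (s t : S) :
    Commute (T s) (T t) := by
  rw [Commute, SemiconjBy, ← hT.map_add, add_comm, hT.map_add]

namespace IsOpSemigroup

variable {T : S → (H →L[ℂ] H)}

theorem extendByOne_zero (hT : IsOpSemigroup T) : extendByOne T 0 = 1 := by
  rw [extendByOne_of_mem T S.zero_mem, ← hT.map_zero]
  rfl

theorem extendByOne_add (hT : IsOpSemigroup T) {s t : Ω → ℝ} (hs : s ∈ S) (ht : t ∈ S) :
    extendByOne T (s + t) = extendByOne T s * extendByOne T t := by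
  rw [extendByOne_of_mem T (S.add_mem hs ht), extendByOne_of_mem T hs, extendByOne_of_mem T ht,
    ← hT.map_add]
  rfl

theorem extendByOne_commute (hT : IsOpSemigroup T) {s t : Ω → ℝ} (hs : s ∈ S) (ht : t ∈ S) :
    Commute (extendByOne T s) (extendByOne T t) := by
  rw [Commute, SemiconjBy, ← hT.extendByOne_add hs ht, add_comm, hT.extendByOne_add ht hs]

theorem extendByOne_nsmul (hT : IsOpSemigroup T) {s : Ω → ℝ} (hs : s ∈ S) (n : ℕ) :
    extendByOne T (n • s) = extendByOne T s ^ n := by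
  induction n with
  | zero => simpa using hT.extendByOne_zero
  | succ n ih => rw [succ_nsmul, hT.extendByOne_add (S.nsmul_mem hs n) hs, ih, pow_succ]

end IsOpSemigroup

variable [CompleteSpace H]

/-- `T_{s₋}^* T_{s₊}` as a function of `s ∈ ℝ^Ω`. -/
noncomputable def regularSymbol (T : S → (H →L[ℂ] H)) (s : Ω → ℝ) : H →L[ℂ] H :=
  star (extendByOne T s⁻) * extendByOne T s⁺

theorem groupExtension_eq_regularSymbol (hS : PosNegClosed S) (T : S → (H →L[ℂ] H))
    (s : AddSubgroup.closure (S : Set (Ω → ℝ))) : groupExtension hS T s = regularSymbol T s := by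
  rw [groupExtension, regularSymbol, extendByOne_of_mem T (hS s s.2).1,
    extendByOne_of_mem T (hS s s.2).2]
  rfl

theorem regularSymbol_neg (T : S → (H →L[ℂ] H)) (s : Ω → ℝ) :
    regularSymbol T (-s) = star (regularSymbol T s) := by
  simp [regularSymbol]

theorem regularSymbol_zero {T : S → (H →L[ℂ] H)} (hT : IsOpSemigroup T) :
    regularSymbol T 0 = 1 := by
  simp [regularSymbol, hT.extendByOne_zero]

theorem posPart_sub_of_disjoint {s t : Ω → ℝ} (hs : 0 ≤ s) (ht : 0 ≤ t)
    (h : ∀ j, s j = 0 ∨ t j = 0) : (s - t)⁺ = s ∧ (s - t)⁻ = t := by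
  refine ⟨funext fun j => ?_, funext fun j => ?_⟩ <;> have h1 := hs j <;> have h2 := ht j <;>
    simp only [Pi.zero_apply, Pi.posPart_apply, Pi.negPart_apply, Pi.sub_apply] at * <;>
    rcases h j with h | h <;> simp [h, h1, h2]

theorem regularSymbol_sub_of_disjoint (T : S → (H →L[ℂ] H)) {s t : Ω → ℝ} (hs : 0 ≤ s)
    (ht : 0 ≤ t) (h : ∀ j, s j = 0 ∨ t j = 0) :
    regularSymbol T (s - t) = star (extendByOne T t) * extendByOne T s := by
  rw [regularSymbol, (posPart_sub_of_disjoint hs ht h).1, (posPart_sub_of_disjoint hs ht h).2]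

end Symbol

/-! ### Multiplicativity of the symbol over disjoint supports. -/

section DoublyCommuting

variable {Ω : Type*} {𝒮 : Ω → AddSubmonoid ℝ}
variable {H : Type*} [NormedAddCommGroup H] [InnerProductSpace ℂ H] [CompleteSpace H]
variable {T : sumSemigroup 𝒮 → (H →L[ℂ] H)}

open Classical in
theorem DoublyCommutes.commute_single (hdc : DoublyCommutes T) {i j : Ω} (hij : i ≠ j) {a b : ℝ}
    (ha : a ∈ 𝒮 i) (hb : b ∈ 𝒮 j) :
    Commute (extendByOne T (Pi.single j b)) (star (extendByOne T (Pi.single i a))) := by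
  rw [extendByOne_of_mem T (sumSemigroup.single_mem ha),
    extendByOne_of_mem T (sumSemigroup.single_mem hb)]
  exact hdc i j hij ⟨a, ha⟩ ⟨b, hb⟩

/-- Both elements are sums of single-coordinate ones, and disjointness guarantees that only pairs of
distinct coordinates meet. -/
theorem DoublyCommutes.commute_star (hdc : DoublyCommutes T) (hT : IsOpSemigroup T)
    {s t : Ω → ℝ} (hs : s ∈ sumSemigroup 𝒮) (ht : t ∈ sumSemigroup 𝒮)
    (h : ∀ j, s j = 0 ∨ t j = 0) :
    Commute (extendByOne T s) (star (extendByOne T t)) := by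
  classical
  refine sumSemigroup.induction hs (p := fun r => Commute (extendByOne T r) _) ?_ ?_
  · rw [hT.extendByOne_zero]
    exact Commute.one_left _
  · intro i hi r hr ih
    rw [hT.extendByOne_add (sumSemigroup.single_mem (hs.2 i)) hr]
    refine Commute.mul_left ?_ ih
    refine sumSemigroup.induction ht (p := fun r => Commute _ (star (extendByOne T r))) ?_ ?_
    · rw [hT.extendByOne_zero, star_one]
      exact Commute.one_right _
    · intro j hj q hq ih'
      rw [hT.extendByOne_add (sumSemigroup.single_mem (ht.2 j)) hq, star_mul]
      refine Commute.mul_right ih' (hdc.commute_single ?_ (ht.2 j) (hs.2 i))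
      rintro rfl
      exact (h j).elim hi hj

theorem DoublyCommutes.regularSymbol_add (hdc : DoublyCommutes T) (hT : IsOpSemigroup T)
    {s t : Ω → ℝ} (hs : s⁺ ∈ sumSemigroup 𝒮 ∧ s⁻ ∈ sumSemigroup 𝒮)
    (ht : t⁺ ∈ sumSemigroup 𝒮 ∧ t⁻ ∈ sumSemigroup 𝒮) (h : ∀ j, s j = 0 ∨ t j = 0) :
    regularSymbol T (s + t) = regularSymbol T s * regularSymbol T t := by
  have e : s + t = (s⁺ + t⁺) - (s⁻ + t⁻) := by
    rw [add_sub_add_comm, posPart_sub_negPart, posPart_sub_negPart]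
  rw [e, regularSymbol_sub_of_disjoint, hT.extendByOne_add hs.1 ht.1,
    hT.extendByOne_add hs.2 ht.2, star_mul, regularSymbol, regularSymbol]
  · have h1 : Commute (extendByOne T s⁺) (star (extendByOne T t⁻)) :=
      hdc.commute_star hT hs.1 ht.2 fun j => (h j).imp
        (by simp +contextual [Pi.posPart_apply]) (by simp +contextual [Pi.negPart_apply])
    have h2 : Commute (star (extendByOne T s⁻)) (star (extendByOne T t⁻)) :=
      (hT.extendByOne_commute hs.2 ht.2).star_star
    rw [mul_assoc, mul_assoc, ← mul_assoc (extendByOne T s⁺), h1.eq]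
    simp only [← mul_assoc]
    rw [h2.eq]
  · exact add_nonneg (posPart_nonneg s) (posPart_nonneg t)
  · exact add_nonneg (negPart_nonneg s) (negPart_nonneg t)
  · intro j
    rcases h j with h | h <;> rcases le_total 0 (s j) with h1 | h1 <;>
      rcases le_total 0 (t j) with h2 | h2 <;>
      simp [Pi.posPart_apply, Pi.negPart_apply, h, h1, h2]

theorem DoublyCommutes.regularSymbol_commute (hdc : DoublyCommutes T) (hT : IsOpSemigroup T)
    {s t : Ω → ℝ} (hs : s⁺ ∈ sumSemigroup 𝒮 ∧ s⁻ ∈ sumSemigroup 𝒮) (ht : t ∈ sumSemigroup 𝒮)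
    (h : ∀ j, s j = 0 ∨ t j = 0) :
    Commute (regularSymbol T s) (extendByOne T t) := by
  refine Commute.mul_left ?_ (hT.extendByOne_commute hs.1 ht)
  exact (hdc.commute_star hT ht hs.2
    fun j => (h j).symm.imp id (by simp +contextual [Pi.negPart_apply])).symm

theorem DoublyCommutes.regularSymbol_commute_star (hdc : DoublyCommutes T) (hT : IsOpSemigroup T)
    {s t : Ω → ℝ} (hs : s⁺ ∈ sumSemigroup 𝒮 ∧ s⁻ ∈ sumSemigroup 𝒮) (ht : t ∈ sumSemigroup 𝒮)
    (h : ∀ j, s j = 0 ∨ t j = 0) :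
    Commute (regularSymbol T s) (star (extendByOne T t)) := by
  refine Commute.mul_left (hT.extendByOne_commute hs.2 ht).star_star ?_
  exact hdc.commute_star hT hs.1 ht
    fun j => (h j).imp (by simp +contextual [Pi.posPart_apply]) id

-- The subtractions of exponents are truncated, so at least one of the two powers is trivial; they
-- encode the positive and negative parts of $(n-m)c$.
open Classical in
theorem regularSymbol_single (hT : IsOpSemigroup T) {i : Ω} {c : ℝ} (hc : c ∈ 𝒮 i) (hc0 : 0 ≤ c)
    (m n : ℕ) :
    regularSymbol T (Pi.single i (n * c - m * c)) =
      star (extendByOne T (Pi.single i c)) ^ (m - n) * extendByOne T (Pi.single i c) ^ (n - m) := by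
  have e : (Pi.single i (n * c - m * c) : Ω → ℝ) =
      (n - m) • Pi.single i c - (m - n) • Pi.single i c := by
    rw [← Pi.single_smul, ← Pi.single_smul, ← Pi.single_sub]
    congr 1
    rcases le_total n m with h | h <;> simp [h, Nat.cast_sub h, sub_mul]
  have h0 : (0 : Ω → ℝ) ≤ Pi.single i c := by simpa using hc0
  rw [e, regularSymbol_sub_of_disjoint _ (nsmul_nonneg h0 _) (nsmul_nonneg h0 _),
    hT.extendByOne_nsmul (sumSemigroup.single_mem hc),
    hT.extendByOne_nsmul (sumSemigroup.single_mem hc), star_pow]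
  intro j
  rcases le_total n m with h | h <;> simp [h]

end DoublyCommuting

/-! ### Factoring the Toeplitz matrix of a contraction. -/

section Toeplitz

/-- The entries of a triangular factor of the Toeplitz matrix of a contraction `C` with defect
operator `D`. -/
def toeplitzFactor {A : Type*} [Ring A] (C D : A) : ℕ → ℕ → A
  | 0, n => C ^ n
  | k + 1, n => if k < n then D * C ^ (n - 1 - k) else 0

/-- The sum telescopes: since $C^*C+D^*D=1$, row $N+1$ strips one factor $C^*$ and one factor $C$
from the middle, as long as both are left. Once $N\ge\min(m,n)$ this is the Toeplitz entry. -/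
theorem sum_star_toeplitzFactor_mul {A : Type*} [Ring A] [StarRing A] {C D : A}
    (hD : star D * D = 1 - star C * C) (m n N : ℕ) :
    ∑ k ∈ Finset.range (N + 1), star (toeplitzFactor C D k m) * toeplitzFactor C D k n =
      star C ^ (m - min N (min m n)) * C ^ (n - min N (min m n)) := by
  induction N with
  | zero => simp [toeplitzFactor]
  | succ N ih =>
    rw [Finset.sum_range_succ, ih]
    by_cases h : N < m ∧ N < n
    · have h1 : m - min N (min m n) = m - 1 - N + 1 := by omega
      have h2 : n - min N (min m n) = n - 1 - N + 1 := by omega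
      have h3 : m - min (N + 1) (min m n) = m - 1 - N := by omega
      have h4 : n - min (N + 1) (min m n) = n - 1 - N := by omega
      rw [h1, h2, h3, h4]
      simp only [toeplitzFactor, if_pos h.1, if_pos h.2, star_mul, star_pow]
      calc _ = star C ^ (m - 1 - N) * (star C * C) * C ^ (n - 1 - N)
            + star C ^ (m - 1 - N) * (star D * D) * C ^ (n - 1 - N) := by
            rw [pow_succ (star C), pow_succ' C]
            simp only [mul_assoc]
        _ = _ := by rw [hD]; noncomm_ring
    · have h1 : min N (min m n) = min (N + 1) (min m n) := by omega
      have h2 : star (toeplitzFactor C D (N + 1) m) * toeplitzFactor C D (N + 1) n = 0 := by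
        rcases not_and_or.1 h with h | h <;> simp [toeplitzFactor, h]
      rw [h1, h2, add_zero]

theorem Commute.toeplitzFactor {A : Type*} [Ring A] {B C D : A} (hC : Commute B C)
    (hD : Commute B D) (k n : ℕ) : Commute B (toeplitzFactor C D k n) := by
  cases k with
  | zero => exact hC.pow_right n
  | succ k =>
    simp only [_root_.toeplitzFactor]
    split_ifs
    · exact hD.mul_right (hC.pow_right _)
    · exact Commute.zero_right _

/-- A contraction has a defect operator commuting with everything that commutes with the
contraction and its adjoint. -/
theorem exists_defect_operator {H : Type*} [NormedAddCommGroup H] [InnerProductSpace ℂ H]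
    [CompleteSpace H] {C : H →L[ℂ] H} (hC : ‖C‖ ≤ 1) :
    ∃ D : H →L[ℂ] H, star D * D = 1 - star C * C ∧
      ∀ B, Commute B C → Commute B (star C) → Commute B D := by
  have hle : star C * C ≤ 1 := by
    rw [← CStarAlgebra.norm_le_one_iff_of_nonneg _ (star_mul_self_nonneg C),
      CStarRing.norm_star_mul_self]
    exact mul_le_one₀ hC (norm_nonneg _) hC
  have h0 : 0 ≤ 1 - star C * C := sub_nonneg.2 hle
  have hsa : star (CFC.sqrt (1 - star C * C)) = CFC.sqrt (1 - star C * C) :=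
    (CFC.sqrt_nonneg _).isSelfAdjoint
  refine ⟨CFC.sqrt (1 - star C * C), ?_, fun B h1 h2 => ?_⟩
  · rw [hsa, CFC.sqrt_mul_sqrt_self _ h0]
  -- The root belongs to the functional calculus of $1-C^*C$, with which `B` commutes.
  · rw [CFC.sqrt]
    exact (Commute.cfcₙ_nnreal ((Commute.one_right B).sub_right (h2.mul_right h1)).symm _).symm

end Toeplitz

/-! ### Positive definiteness of the symbol. -/

section Positivity

/-- Positive definiteness on a finite set is preserved by multiplication with a factorized kernel
commuting with the given one. -/
theorem positive_kernel_mul_sum {I H : Type*} [NormedAddCommGroup H] [InnerProductSpace ℂ H]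
    [CompleteSpace H] (X : Finset I) {P : I → I → (H →L[ℂ] H)}
    (hP : ∀ h : I → H, 0 ≤ (∑ p ∈ X, ∑ q ∈ X, inner ℂ (h p) (P p q (h q))).re)
    {ι : Type*} (F : Finset ι) (A : ι → I → (H →L[ℂ] H))
    (hA : ∀ p ∈ X, ∀ q ∈ X, ∀ k, Commute (P p q) (star (A k p))) (h : I → H) :
    0 ≤ (∑ p ∈ X, ∑ q ∈ X,
      inner ℂ (h p) ((P p q * ∑ k ∈ F, star (A k p) * A k q) (h q))).re := by
  have e : ∑ p ∈ X, ∑ q ∈ X, inner ℂ (h p) ((P p q * ∑ k ∈ F, star (A k p) * A k q) (h q)) =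
      ∑ k ∈ F, ∑ p ∈ X, ∑ q ∈ X, inner ℂ (A k p (h p)) (P p q (A k q (h q))) := by
    rw [Finset.sum_comm' (t' := X) (s' := fun _ => F) (by simp [and_comm])]
    refine Finset.sum_congr rfl fun p hp => ?_
    rw [Finset.sum_comm' (t' := X) (s' := fun _ => F) (by simp [and_comm])]
    refine Finset.sum_congr rfl fun q hq => ?_
    rw [Finset.mul_sum, sum_apply, inner_sum]
    refine Finset.sum_congr rfl fun k _ => ?_
    rw [← mul_assoc, (hA p hp q hq k).eq, ← ContinuousLinearMap.adjoint_inner_right]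
    rfl
  rw [e, Complex.re_sum]
  exact Finset.sum_nonneg fun k _ => hP fun p => A k p (h p)

theorem IsCommensurable.exists_finset {M : Type*} [AddMonoid M] (hM : IsCommensurable M)
    {I : Type*} (X : Finset I) (s : I → M) : ∃ (c : M) (a : I → ℕ), ∀ p ∈ X, s p = a p • c := by
  classical
  obtain ⟨c, a, h⟩ := hM X.card fun k => s (X.equivFin.symm k)
  refine ⟨c, fun p => if hp : p ∈ X then a (X.equivFin ⟨p, hp⟩) else 0, fun p hp => ?_⟩
  simpa [hp] using h (X.equivFin ⟨p, hp⟩)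

/-- Differences of coordinates of finitely many points of the group are differences of natural
multiples of one element. -/
theorem exists_common_unit {Ω : Type*} {𝒮 : Ω → AddSubmonoid ℝ} {i : Ω}
    (hcomm : IsCommensurable (𝒮 i)) (hS : PosNegClosed (sumSemigroup 𝒮)) {I : Type*} (X : Finset I)
    (x : I → Ω → ℝ) (hx : ∀ p, x p ∈ AddSubgroup.closure (sumSemigroup 𝒮 : Set (Ω → ℝ))) :
    ∃ c ∈ 𝒮 i, ∃ n : I → ℕ, ∀ p ∈ X, ∀ q ∈ X, x q i - x p i = n q * c - n p * c := by
  obtain ⟨c, a, h⟩ := hcomm.exists_finset (X ×ˢ (Finset.univ : Finset Bool)) fun p =>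
    if p.2 then ⟨(x p.1)⁺ i, (hS _ (hx p.1)).1.2 i⟩ else ⟨(x p.1)⁻ i, (hS _ (hx p.1)).2.2 i⟩
  -- Coordinates may be negative multiples of `c`. Adding the same constant `∑ r ∈ X, a (r, false)`
  -- to all of them makes them natural and cancels in differences.
  refine ⟨c, c.2, fun p => a (p, true) + (∑ r ∈ X, a (r, false) - a (p, false)), ?_⟩
  have hdiff : ∀ p ∈ X, x p i = a (p, true) * (c : ℝ) - a (p, false) * c := by
    intro p hp
    have h1 := congrArg Subtype.val (h (p, true) (by simp [hp]))
    have h2 := congrArg Subtype.val (h (p, false) (by simp [hp]))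
    simp only [if_true, Bool.false_eq_true, if_false, AddSubmonoidClass.coe_nsmul,
      nsmul_eq_mul] at h1 h2
    rw [← h1, ← h2, ← Pi.sub_apply, posPart_sub_negPart]
  have hle : ∀ p ∈ X, a (p, false) ≤ ∑ r ∈ X, a (r, false) := fun p hp =>
    Finset.single_le_sum (f := fun r => a (r, false)) (fun _ _ => Nat.zero_le _) hp
  intro p hp q hq
  rw [hdiff p hp, hdiff q hq]
  push_cast [Nat.cast_sub (hle p hp), Nat.cast_sub (hle q hq)]
  ring

variable {Ω : Type*} {𝒮 : Ω → AddSubmonoid ℝ}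
variable {H : Type*} [NormedAddCommGroup H] [InnerProductSpace ℂ H] [CompleteSpace H]
variable {T : sumSemigroup 𝒮 → (H →L[ℂ] H)}

/-- Induction on the set of active coordinates: a new coordinate multiplies the kernel by a factored
Toeplitz kernel commuting with it. With no coordinates the form is $\|\sum_p h_p\|^2$. -/
theorem regularSymbol_indicator_positive (hpos : ∀ i, ∀ x ∈ 𝒮 i, 0 ≤ x)
    (hcomm : ∀ i, IsCommensurable (𝒮 i)) (hT : IsContractiveSemigroup T) (hdc : DoublyCommutes T)
    {I : Type*} (X : Finset I) (x : I → Ω → ℝ)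
    (hx : ∀ p, x p ∈ AddSubgroup.closure (sumSemigroup 𝒮 : Set (Ω → ℝ))) (F : Finset Ω) :
    ∀ h : I → H, 0 ≤ (∑ p ∈ X, ∑ q ∈ X,
      inner ℂ (h p) (regularSymbol T ((F : Set Ω).indicator (x q - x p)) (h q))).re := by
  classical
  have hS := sumSemigroup_posNegClosed hpos hcomm
  induction F using Finset.induction_on with
  | empty =>
    intro h
    have e : ∑ p ∈ X, ∑ q ∈ X, inner ℂ (h p) (regularSymbol T
        (((∅ : Finset Ω) : Set Ω).indicator (x q - x p)) (h q)) =
        inner ℂ (∑ p ∈ X, h p) (∑ q ∈ X, h q) := by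
      rw [sum_inner]
      refine Finset.sum_congr rfl fun p _ => ?_
      rw [inner_sum]
      refine Finset.sum_congr rfl fun q _ => ?_
      have h0 : ((∅ : Finset Ω) : Set Ω).indicator (x q - x p) = 0 := by
        rw [Finset.coe_empty, Set.indicator_empty']
      rw [h0, regularSymbol_zero hT.toIsOpSemigroup]
      rfl
    rw [e]
    exact inner_self_nonneg (𝕜 := ℂ)
  | insert i F hi ih =>
    obtain ⟨c, hc, n, hn⟩ := exists_common_unit (hcomm i) hS X x hx
    have hcS : Pi.single i c ∈ sumSemigroup 𝒮 := sumSemigroup.single_mem hc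
    obtain ⟨D, hD, hDcomm⟩ := exists_defect_operator
      ((extendByOne_of_mem T hcS).symm ▸ hT.norm_le_one ⟨_, hcS⟩)
    set C := extendByOne T (Pi.single i c)
    intro h
    have hmem : ∀ p q, x q - x p ∈ AddSubgroup.closure (sumSemigroup 𝒮 : Set (Ω → ℝ)) :=
      fun p q => sub_mem (hx q) (hx p)
    have hdisj : ∀ p q j, (F : Set Ω).indicator (x q - x p) j = 0 ∨
        (Pi.single i c : Ω → ℝ) j = 0 := by
      intro p q j
      by_cases hj : j = i
      · subst hj
        exact Or.inl (by simp [hi])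
      · exact Or.inr (by simp [hj])
    have hcommC : ∀ p q, Commute (regularSymbol T ((F : Set Ω).indicator (x q - x p))) C :=
      fun p q => hdc.regularSymbol_commute hT.toIsOpSemigroup
        (sumSemigroup.posPart_negPart_indicator_mem hS (hmem p q) F) hcS (hdisj p q)
    have hcommCs : ∀ p q,
        Commute (regularSymbol T ((F : Set Ω).indicator (x q - x p))) (star C) :=
      fun p q => hdc.regularSymbol_commute_star hT.toIsOpSemigroup
        (sumSemigroup.posPart_negPart_indicator_mem hS (hmem p q) F) hcS (hdisj p q)
    have hstar : ∀ p q, star (regularSymbol T ((F : Set Ω).indicator (x q - x p))) =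
        regularSymbol T ((F : Set Ω).indicator (x p - x q)) := by
      intro p q
      rw [← regularSymbol_neg, ← Set.indicator_neg', neg_sub]
    have hcommA : ∀ p ∈ X, ∀ q ∈ X, ∀ k,
        Commute (regularSymbol T ((F : Set Ω).indicator (x q - x p)))
          (star (toeplitzFactor C D k (n p))) := by
      intro p _ q _ k
      -- Passing to adjoints swaps `p` and `q` in the symbol and removes the star from the Toeplitz
      -- factor.
      rw [← star_star (regularSymbol T _), commute_star_star, hstar]
      exact Commute.toeplitzFactor (hcommC q p) (hDcomm _ (hcommC q p) (hcommCs q p)) k _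
    -- `∑ r ∈ X, n r` bounds every `n p`, so enough rows are summed to obtain the full Toeplitz
    -- entries.
    convert positive_kernel_mul_sum X ih (Finset.range (∑ r ∈ X, n r + 1))
      (fun k p => toeplitzFactor C D k (n p)) hcommA h using 1
    congr 1
    refine Finset.sum_congr rfl fun p hp => Finset.sum_congr rfl fun q hq => ?_
    have hmin : min (∑ r ∈ X, n r) (min (n p) (n q)) = min (n p) (n q) :=
      min_eq_right ((min_le_left _ _).trans
        (Finset.single_le_sum (f := n) (fun _ _ => Nat.zero_le _) hp))
    have hmn : n p - min (n p) (n q) = n p - n q := by omega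
    have hnm : n q - min (n p) (n q) = n q - n p := by omega
    rw [sum_star_toeplitzFactor_mul hD, hmin, hmn, hnm,
      ← regularSymbol_single hT.toIsOpSemigroup hc (hpos i c hc), ← hn p hp q hq,
      Finset.coe_insert, Set.indicator_insert_eq_single_add (by simpa using hi), add_comm,
      hdc.regularSymbol_add hT.toIsOpSemigroup
        (sumSemigroup.posPart_negPart_indicator_mem hS (hmem p q) F) _ _]
    · rfl
    · have := sumSemigroup.posPart_negPart_indicator_mem hS (hmem p q) {i}
      rwa [← insert_empty_eq, Set.indicator_insert_eq_single_add (by simp),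
        Set.indicator_empty', add_zero] at this
    · intro j
      by_cases hj : j = i
      · subst hj
        exact Or.inl (by simp [hi])
      · exact Or.inr (by simp [hj])

theorem finite_support_of_mem_closure (hS : PosNegClosed (sumSemigroup 𝒮)) {s : Ω → ℝ}
    (hs : s ∈ AddSubgroup.closure (sumSemigroup 𝒮 : Set (Ω → ℝ))) :
    (Function.support s).Finite := by
  rw [← posPart_sub_negPart s]
  exact ((hS s hs).1.1.union (hS s hs).2.1).subset (Function.support_sub _ _)

theorem regularSymbol_positive (hpos : ∀ i, ∀ x ∈ 𝒮 i, 0 ≤ x)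
    (hcomm : ∀ i, IsCommensurable (𝒮 i)) (hT : IsContractiveSemigroup T) (hdc : DoublyCommutes T)
    {I : Type*} (X : Finset I) (x : I → Ω → ℝ)
    (hx : ∀ p, x p ∈ AddSubgroup.closure (sumSemigroup 𝒮 : Set (Ω → ℝ))) (h : I → H) :
    0 ≤ (∑ p ∈ X, ∑ q ∈ X, inner ℂ (h p) (regularSymbol T (x q - x p) (h q))).re := by
  have hS := sumSemigroup_posNegClosed hpos hcomm
  have hfin : (⋃ p ∈ X, Function.support (x p)).Finite :=
    X.finite_toSet.biUnion fun p _ => finite_support_of_mem_closure hS (hx p)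
  -- Finitely many points have finite joint support, outside which their differences vanish.
  convert regularSymbol_indicator_positive hpos hcomm hT hdc X x hx hfin.toFinset h using 1
  congr 1
  refine Finset.sum_congr rfl fun p hp => Finset.sum_congr rfl fun q hq => ?_
  rw [Set.indicator_eq_self.2]
  rw [Set.Finite.coe_toFinset]
  refine (Function.support_sub _ _).trans (Set.union_subset ?_ ?_)
  · exact Set.subset_biUnion_of_mem (u := fun r => Function.support (x r)) hq
  · exact Set.subset_biUnion_of_mem (u := fun r => Function.support (x r)) hp

end Positivity

/-! ### Dilations by shifts along a total family. -/

section ShiftDilation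

open ContinuousLinearMap

variable {Ω : Type*} {S : AddSubmonoid (Ω → ℝ)}
variable {H : Type*} [NormedAddCommGroup H] [InnerProductSpace ℂ H] [CompleteSpace H]
variable {K : Type*} [NormedAddCommGroup K] [InnerProductSpace ℂ K] [CompleteSpace K]
variable {X : Type*} [AddCommMonoid X]

/-- `Λ` is a total family of operators with Gram operators `T(y - x)`, and `V` is the semigroup of
shifts along it. -/
structure IsShiftDilation (val : X →+ (Ω → ℝ)) (inc : S →+ X) (T : S → (H →L[ℂ] H))
    (Λ : X → (H →L[ℂ] K)) (J : H →ₗᵢ[ℂ] K) (V : S → (K →L[ℂ] K)) : Prop where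
  val_inc : ∀ s, val (inc s) = s
  gram : ∀ x y, adjoint (Λ x) ∘L Λ y = regularSymbol T (val y - val x)
  total : (Submodule.span ℂ {z : K | ∃ x v, z = Λ x v}).topologicalClosure = ⊤
  embedding : ∀ h, J h = Λ 0 h
  shift : ∀ s x h, V s (Λ x h) = Λ (x + inc s) h
  isometry : ∀ s, Isometry (V s)

theorem Isometry.star_mul_self_eq_one {A : K →L[ℂ] K} (hA : Isometry A) : star A * A = 1 :=
  A.isometry_iff_adjoint_comp_self.1 hA

namespace IsShiftDilation

variable {val : X →+ (Ω → ℝ)} {inc : S →+ X} {T : S → (H →L[ℂ] H)}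
variable {Λ : X → (H →L[ℂ] K)} {J : H →ₗᵢ[ℂ] K} {V : S → (K →L[ℂ] K)}

theorem isOpSemigroup (hV : IsShiftDilation val inc T Λ J V) : IsOpSemigroup V where
  map_zero := ext_of_total hV.total fun x h => by simp [hV.shift]
  map_add s t := ext_of_total hV.total fun x h => by
    simp [hV.shift, add_assoc, add_comm (inc t)]

theorem shift_embedding (hV : IsShiftDilation val inc T Λ J V) (s : S) (h : H) :
    V s (J h) = Λ (inc s) h := by
  rw [hV.embedding, hV.shift, zero_add]

theorem star_shift (hV : IsShiftDilation val inc T Λ J V) (s : S) (x : X) (h : H) :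
    star (V s) (Λ (x + inc s) h) = Λ x h := by
  rw [← hV.shift]
  exact congrArg (fun A : K →L[ℂ] K => A (Λ x h)) (hV.isometry s).star_mul_self_eq_one

/-- Since $V_tJ=\Lambda_t$, the compression of $V_{s_-}^*V_{s_+}$ is the Gram operator
$\Lambda_{s_-}^*\Lambda_{s_+}$, and $s_+-s_-=s$. -/
theorem isRegularDilation (hV : IsShiftDilation val inc T Λ J V) (hS : PosNegClosed S) :
    IsRegularDilation hS T J V := by
  intro s
  have e : ∀ t : S, V t ∘L J.toContinuousLinearMap = Λ (inc t) := fun t => by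
    ext h
    exact hV.shift_embedding t h
  rw [groupExtension_eq_regularSymbol hS T, groupExtension, mul_def, comp_assoc, ← comp_assoc, e,
    ← adjoint_comp, e, hV.gram, hV.val_inc, hV.val_inc]
  congr 1
  exact posPart_sub_negPart _

end IsShiftDilation

end ShiftDilation

/-- The index monoid `X` is left open so that one construction serves both the group and the
semigroup. Translating both arguments preserves the kernel, hence the isometric shifts; the symbol
at $0$ is $1$, hence $\Lambda_0$ embeds $H$. -/
theorem exists_isShiftDilation {Ω : Type*} {𝒮 : Ω → AddSubmonoid ℝ}
    (hpos : ∀ i, ∀ x ∈ 𝒮 i, 0 ≤ x) (hcomm : ∀ i, IsCommensurable (𝒮 i))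
    {H : Type v} [NormedAddCommGroup H] [InnerProductSpace ℂ H] [CompleteSpace H]
    {T : sumSemigroup 𝒮 → (H →L[ℂ] H)} (hT : IsContractiveSemigroup T) (hdc : DoublyCommutes T)
    {X : Type u} [AddCommMonoid X] (val : X →+ (Ω → ℝ)) (inc : sumSemigroup 𝒮 →+ X)
    (hval : ∀ x, val x ∈ AddSubgroup.closure (sumSemigroup 𝒮 : Set (Ω → ℝ)))
    (hinc : ∀ s, val (inc s) = s) :
    ∃ (K : Type (max u v)) (_ : NormedAddCommGroup K) (_ : InnerProductSpace ℂ K)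
      (_ : CompleteSpace K) (Λ : X → (H →L[ℂ] K)) (J : H →ₗᵢ[ℂ] K)
      (V : sumSemigroup 𝒮 → (K →L[ℂ] K)), IsShiftDilation val inc T Λ J V := by
  obtain ⟨K, _, _, _, Λ, hgram, htotal⟩ := exists_kolmogorov_decomposition
    (fun x y => regularSymbol T (val y - val x))
    (fun x y => by rw [← regularSymbol_neg, neg_sub])
    (fun f => regularSymbol_positive hpos hcomm hT hdc f.support val hval f)
  have hV : ∀ s, ∃ W : K →ₗᵢ[ℂ] K, ∀ x v, W (Λ x v) = Λ (x + inc s) v := fun s =>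
    exists_linearIsometry_of_gram_eq (Λ' := fun x => Λ (x + inc s)) htotal fun x y => by
      rw [hgram, hgram, map_add, map_add, add_sub_add_right_eq_sub]
  choose W hW using hV
  have hJ : ∀ h, ‖Λ 0 h‖ = ‖h‖ := by
    rw [ContinuousLinearMap.norm_map_iff_adjoint_comp_self, hgram, sub_self,
      regularSymbol_zero hT.toIsOpSemigroup]
  exact ⟨K, inferInstance, inferInstance, inferInstance, Λ, ⟨(Λ 0 : H →ₗ[ℂ] K), hJ⟩,
    fun s => (W s).toContinuousLinearMap, hinc, hgram, htotal, fun _ => rfl, hW,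
    fun s => (W s).isometry⟩

/-! ### The unitary dilation: existence and uniqueness. -/

section Unitary

open ContinuousLinearMap

variable {Ω : Type*} {S : AddSubmonoid (Ω → ℝ)}
variable {H : Type*} [NormedAddCommGroup H] [InnerProductSpace ℂ H] [CompleteSpace H]
variable {K : Type*} [NormedAddCommGroup K] [InnerProductSpace ℂ K] [CompleteSpace K]

theorem Commute.star_right_of_mem_unitary {A : Type*} [Monoid A] [StarMul A] {a b : A}
    (h : Commute a b) (hb : b ∈ unitary A) : Commute a (star b) :=
  calc a * star b = star b * (b * a) * star b := by
        rw [← mul_assoc, Unitary.star_mul_self_of_mem hb, one_mul]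
    _ = star b * a := by
        rw [← h.eq, mul_assoc, mul_assoc, Unitary.mul_star_self_of_mem hb, mul_one]

variable (S) in
/-- The inclusion of a semigroup into the group it generates. -/
def inclClosure : S →+ AddSubgroup.closure (S : Set (Ω → ℝ)) where
  toFun s := ⟨s, AddSubgroup.subset_closure s.2⟩
  map_zero' := rfl
  map_add' _ _ := rfl

/-- For commuting unitaries any representation of `x` as a difference serves as well as $x_+-x_-$;
this makes `groupExtension` behave as a group representation. -/
theorem groupExtension_of_unitary {U : S → (K →L[ℂ] K)} (hS : PosNegClosed S)
    (hU : IsOpSemigroup U) (hunit : ∀ s, U s ∈ unitary (K →L[ℂ] K))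
    {x : AddSubgroup.closure (S : Set (Ω → ℝ))} {s t : S} (h : (x : Ω → ℝ) = s - t) :
    groupExtension hS U x = star (U t) * U s := by
  set p : S := ⟨(x : Ω → ℝ)⁺, (hS x x.2).1⟩
  set m : S := ⟨(x : Ω → ℝ)⁻, (hS x x.2).2⟩
  have e : p + t = m + s := Subtype.ext <| by
    change (x : Ω → ℝ)⁺ + t = (x : Ω → ℝ)⁻ + s
    rw [sub_eq_sub_iff_add_eq_add.1 ((posPart_sub_negPart (x : Ω → ℝ)).trans h), add_comm]
  calc star (U m) * U p = star (U m) * (U p * U t) * star (U t) := by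
        rw [mul_assoc, mul_assoc, Unitary.mul_star_self_of_mem (hunit t), mul_one]
    _ = star (U m) * (U m * U s) * star (U t) := by rw [← hU.map_add, e, hU.map_add]
    _ = U s * star (U t) := by
        rw [← mul_assoc, Unitary.star_mul_self_of_mem (hunit m), one_mul]
    _ = star (U t) * U s := (hU.commute s t).star_right_of_mem_unitary (hunit t)

theorem coe_eq_posPart_sub_negPart (hS : PosNegClosed S)
    (x : AddSubgroup.closure (S : Set (Ω → ℝ))) : ∃ p m : S, (x : Ω → ℝ) = p - m :=
  ⟨⟨_, (hS x x.2).1⟩, ⟨_, (hS x x.2).2⟩, (posPart_sub_negPart _).symm⟩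

theorem star_groupExtension_mul {U : S → (K →L[ℂ] K)} (hS : PosNegClosed S)
    (hU : IsOpSemigroup U) (hunit : ∀ s, U s ∈ unitary (K →L[ℂ] K))
    (x y : AddSubgroup.closure (S : Set (Ω → ℝ))) :
    star (groupExtension hS U x) * groupExtension hS U y = groupExtension hS U (y - x) := by
  obtain ⟨p, m, hx⟩ := coe_eq_posPart_sub_negPart hS x
  obtain ⟨q, n, hy⟩ := coe_eq_posPart_sub_negPart hS y
  have hxy : ((y - x : AddSubgroup.closure (S : Set (Ω → ℝ))) : Ω → ℝ) =
      ((q + m : S) : Ω → ℝ) - ((n + p : S) : Ω → ℝ) := by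
    rw [AddSubgroup.coe_sub, hx, hy, AddSubmonoid.coe_add, AddSubmonoid.coe_add]
    abel
  rw [groupExtension_of_unitary hS hU hunit hx, groupExtension_of_unitary hS hU hunit hy,
    groupExtension_of_unitary hS hU hunit hxy, hU.map_add, hU.map_add, star_mul, star_mul,
    star_star, mul_assoc, mul_assoc, ← mul_assoc (U m), ← mul_assoc (star (U n)),
    ((hU.commute m n).star_right_of_mem_unitary (hunit n)).eq, mul_assoc, (hU.commute m q).eq,
    ← mul_assoc (star (U n))]

theorem mul_groupExtension {U : S → (K →L[ℂ] K)} (hS : PosNegClosed S)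
    (hU : IsOpSemigroup U) (hunit : ∀ s, U s ∈ unitary (K →L[ℂ] K))
    (x : AddSubgroup.closure (S : Set (Ω → ℝ))) (s : S) :
    U s * groupExtension hS U x = groupExtension hS U (x + inclClosure S s) := by
  obtain ⟨p, m, hx⟩ := coe_eq_posPart_sub_negPart hS x
  have hxs : ((x + inclClosure S s : AddSubgroup.closure (S : Set (Ω → ℝ))) : Ω → ℝ) =
      ((s + p : S) : Ω → ℝ) - (m : Ω → ℝ) := by
    rw [AddSubgroup.coe_add, hx, AddSubmonoid.coe_add, add_sub_assoc, add_comm]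
    rfl
  rw [groupExtension_of_unitary hS hU hunit hx, groupExtension_of_unitary hS hU hunit hxs,
    hU.map_add, ← mul_assoc, ← mul_assoc,
    ((hU.commute s m).star_right_of_mem_unitary (hunit m)).eq]

theorem DoublyCommutes.of_unitary {𝒮 : Ω → AddSubmonoid ℝ} {U : sumSemigroup 𝒮 → (K →L[ℂ] K)}
    (hU : IsOpSemigroup U) (hunit : ∀ s, U s ∈ unitary (K →L[ℂ] K)) : DoublyCommutes U :=
  fun _ _ _ _ _ => ((hU.commute _ _).star_right_of_mem_unitary (hunit _)).eq

theorem regular_gram {hS : PosNegClosed S} {T : S → (H →L[ℂ] H)} {J : H →ₗᵢ[ℂ] K}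
    {U : S → (K →L[ℂ] K)} (hreg : IsRegularDilation hS T J U)
    {x : AddSubgroup.closure (S : Set (Ω → ℝ))} {A B : K →L[ℂ] K}
    (h : star A * B = groupExtension hS U x) :
    adjoint (A ∘L J.toContinuousLinearMap) ∘L (B ∘L J.toContinuousLinearMap) =
      regularSymbol T x := by
  rw [← groupExtension_eq_regularSymbol hS, ← hreg, ← h, adjoint_comp, comp_assoc,
    ← comp_assoc (adjoint A)]
  rfl

theorem IsShiftDilation.isMinimalRegularUnitaryDilation {hS : PosNegClosed S}
    {T : S → (H →L[ℂ] H)} {Λ : AddSubgroup.closure (S : Set (Ω → ℝ)) → (H →L[ℂ] K)}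
    {J : H →ₗᵢ[ℂ] K} {U : S → (K →L[ℂ] K)}
    (hU : IsShiftDilation (AddSubgroup.subtype _) (inclClosure S) T Λ J U) :
    IsMinimalRegularUnitaryDilation hS T J U where
  semigroup := hU.isOpSemigroup
  unitary s := by
    have h := (hU.isometry s).star_mul_self_eq_one
    refine Unitary.mem_iff.2 ⟨h, ext_of_total hU.total fun x v => ?_⟩
    -- Every index is a translate by `s` because the index set is a group, so the shift is onto.
    rw [← sub_add_cancel x (inclClosure S s), mul_def, comp_apply, hU.star_shift, hU.shift]
    rfl
  regular := hU.isRegularDilation hS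
  minimal := by
    have key : ∀ x h, groupExtension hS U x (J h) = Λ x h := by
      intro x h
      have hx : inclClosure S ⟨_, (hS x x.2).1⟩ = x + inclClosure S ⟨_, (hS x x.2).2⟩ :=
        Subtype.ext (sub_eq_iff_eq_add.1 (posPart_sub_negPart (x : Ω → ℝ)))
      rw [groupExtension, mul_def, comp_apply, hU.shift_embedding, hx]
      exact hU.star_shift _ x h
    simpa only [key] using hU.total

theorem IsShiftDilation.dilationEquivalent_unitary {hS : PosNegClosed S} {T : S → (H →L[ℂ] H)}
    {Λ : AddSubgroup.closure (S : Set (Ω → ℝ)) → (H →L[ℂ] K)} {J : H →ₗᵢ[ℂ] K}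
    {U : S → (K →L[ℂ] K)}
    (hU : IsShiftDilation (AddSubgroup.subtype _) (inclClosure S) T Λ J U)
    {K' : Type*} [NormedAddCommGroup K'] [InnerProductSpace ℂ K'] [CompleteSpace K']
    {J' : H →ₗᵢ[ℂ] K'} {U' : S → (K' →L[ℂ] K')}
    (hU' : IsMinimalRegularUnitaryDilation hS T J' U') : DilationEquivalent J U J' U' := by
  obtain ⟨W, hW⟩ := exists_linearIsometryEquiv_of_gram_eq
    (Λ' := fun x => groupExtension hS U' x ∘L J'.toContinuousLinearMap) hU.total hU'.minimal
    fun x y => by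
      rw [hU.gram, regular_gram hU'.regular
        (star_groupExtension_mul hS hU'.semigroup hU'.unitary x y)]
      rfl
  refine ⟨W, fun h => ?_, fun s => ?_⟩
  · have h0 : groupExtension hS U' 0 = 1 := by
      rw [groupExtension_of_unitary hS hU'.semigroup hU'.unitary (s := 0) (t := 0) (by simp),
        hU'.semigroup.map_zero, star_one, one_mul]
    rw [hU.embedding, hW, h0]
    rfl
  · have := ext_of_total hU.total
      (A := (W : K →L[ℂ] K') ∘L U s) (B := U' s ∘L (W : K →L[ℂ] K')) fun x h => by
        simp only [comp_apply, ContinuousLinearEquiv.coe_coe,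
          LinearIsometryEquiv.coe_toContinuousLinearEquiv]
        rw [hU.shift, hW, hW, ← mul_groupExtension hS hU'.semigroup hU'.unitary]
        rfl
    exact fun z => congrArg (fun A => A z) this

end Unitary

/-! ### The isometric dilation: existence, uniqueness and double commutation. -/

section Isometric

open ContinuousLinearMap

variable {Ω : Type*} {𝒮 : Ω → AddSubmonoid ℝ}
variable {H : Type*} [NormedAddCommGroup H] [InnerProductSpace ℂ H] [CompleteSpace H]
variable {K : Type*} [NormedAddCommGroup K] [InnerProductSpace ℂ K] [CompleteSpace K]

/-- With $d=x\wedge y$ one has $x=d+(y-x)_-$ and $y=d+(y-x)_+$, and the common isometry $V_d$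
cancels. -/
theorem star_isometry_mul {V : sumSemigroup 𝒮 → (K →L[ℂ] K)}
    (hS : PosNegClosed (sumSemigroup 𝒮)) (hV : IsOpSemigroup V) (hiso : ∀ s, Isometry (V s))
    (x y : sumSemigroup 𝒮) :
    star (V x) * V y = groupExtension hS V (inclClosure _ y - inclClosure _ x) := by
  set z := inclClosure (sumSemigroup 𝒮) y - inclClosure (sumSemigroup 𝒮) x
  have hz : (z : Ω → ℝ) = y - x := rfl
  set p : sumSemigroup 𝒮 := ⟨(z : Ω → ℝ)⁺, (hS z z.2).1⟩
  set m : sumSemigroup 𝒮 := ⟨(z : Ω → ℝ)⁻, (hS z z.2).2⟩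
  have hd : (x : Ω → ℝ) ⊓ y ∈ sumSemigroup 𝒮 := by
    refine ⟨(x.2.1.union y.2.1).subset fun j hj => ?_, fun j => ?_⟩
    · by_contra h
      simp only [Set.mem_union, Function.mem_support, not_or, not_not] at h
      exact hj (by simp [h.1, h.2])
    · rcases le_total ((x : Ω → ℝ) j) ((y : Ω → ℝ) j) with h | h
      · simpa [h] using x.2.2 j
      · simpa [h] using y.2.2 j
  have hx : x = ⟨_, hd⟩ + m := Subtype.ext <| funext fun j => by
    change (x : Ω → ℝ) j = ((x : Ω → ℝ) ⊓ y) j + (z : Ω → ℝ)⁻ j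
    rcases le_total ((x : Ω → ℝ) j) ((y : Ω → ℝ) j) with h | h <;>
      simp [hz, Pi.negPart_apply, h]
  have hy : y = ⟨_, hd⟩ + p := Subtype.ext <| funext fun j => by
    change (y : Ω → ℝ) j = ((x : Ω → ℝ) ⊓ y) j + (z : Ω → ℝ)⁺ j
    rcases le_total ((x : Ω → ℝ) j) ((y : Ω → ℝ) j) with h | h <;>
      simp [hz, Pi.posPart_apply, h]
  change _ = star (V m) * V p
  have hVx : V x = V ⟨_, hd⟩ * V m := by rw [← hV.map_add, ← hx]
  have hVy : V y = V ⟨_, hd⟩ * V p := by rw [← hV.map_add, ← hy]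
  rw [hVx, hVy, star_mul, mul_assoc, ← mul_assoc _ _ (V p),
    (hiso _).star_mul_self_eq_one, one_mul]

theorem IsShiftDilation.isMinimalRegularIsometricDilation {hS : PosNegClosed (sumSemigroup 𝒮)}
    {T : sumSemigroup 𝒮 → (H →L[ℂ] H)} {Λ : sumSemigroup 𝒮 → (H →L[ℂ] K)} {J : H →ₗᵢ[ℂ] K}
    {V : sumSemigroup 𝒮 → (K →L[ℂ] K)}
    (hV : IsShiftDilation (AddSubmonoid.subtype _) (AddMonoidHom.id _) T Λ J V) :
    IsMinimalRegularIsometricDilation hS T J V where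
  semigroup := hV.isOpSemigroup
  isometry := hV.isometry
  regular := hV.isRegularDilation hS
  minimal := by simpa only [hV.shift_embedding, AddMonoidHom.id_apply] using hV.total

theorem IsShiftDilation.dilationEquivalent_isometric {hS : PosNegClosed (sumSemigroup 𝒮)}
    {T : sumSemigroup 𝒮 → (H →L[ℂ] H)} {Λ : sumSemigroup 𝒮 → (H →L[ℂ] K)} {J : H →ₗᵢ[ℂ] K}
    {V : sumSemigroup 𝒮 → (K →L[ℂ] K)}
    (hV : IsShiftDilation (AddSubmonoid.subtype _) (AddMonoidHom.id _) T Λ J V)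
    {K' : Type*} [NormedAddCommGroup K'] [InnerProductSpace ℂ K'] [CompleteSpace K']
    {J' : H →ₗᵢ[ℂ] K'} {V' : sumSemigroup 𝒮 → (K' →L[ℂ] K')}
    (hV' : IsMinimalRegularIsometricDilation hS T J' V') : DilationEquivalent J V J' V' := by
  obtain ⟨W, hW⟩ := exists_linearIsometryEquiv_of_gram_eq
    (Λ' := fun x => V' x ∘L J'.toContinuousLinearMap) hV.total hV'.minimal
    fun x y => by
      rw [hV.gram, regular_gram hV'.regular (star_isometry_mul hS hV'.semigroup hV'.isometry x y)]
      rfl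
  refine ⟨W, fun h => ?_, fun s => ?_⟩
  · rw [hV.embedding, hW, hV'.semigroup.map_zero]
    rfl
  · have := ext_of_total hV.total
      (A := (W : K →L[ℂ] K') ∘L V s) (B := V' s ∘L (W : K →L[ℂ] K')) fun x h => by
        simp only [comp_apply, ContinuousLinearEquiv.coe_coe,
          LinearIsometryEquiv.coe_toContinuousLinearEquiv]
        rw [hV.shift, hW, hW, add_comm, AddMonoidHom.id_apply, hV'.semigroup.map_add]
        rfl
    exact fun z => congrArg (fun A => A z) this

open Classical in
/-- If `x` vanishes at `i`, then `V_{e_i(c)}^*` acts on the range of `Λ x` as `T_{e_i(c)}^*`. -/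
theorem IsShiftDilation.adjoint_apply_of_apply_eq_zero (hpos : ∀ i, ∀ x ∈ 𝒮 i, 0 ≤ x)
    (hS : PosNegClosed (sumSemigroup 𝒮))
    {T : sumSemigroup 𝒮 → (H →L[ℂ] H)} (hT : IsOpSemigroup T) (hdc : DoublyCommutes T)
    {Λ : sumSemigroup 𝒮 → (H →L[ℂ] K)} {J : H →ₗᵢ[ℂ] K} {V : sumSemigroup 𝒮 → (K →L[ℂ] K)}
    (hV : IsShiftDilation (AddSubmonoid.subtype _) (AddMonoidHom.id _) T Λ J V)
    {i : Ω} (c : 𝒮 i) {x : sumSemigroup 𝒮} (hx : (x : Ω → ℝ) i = 0) (h : H) :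
    adjoint (V (sumSemigroup.incl 𝒮 i c)) (Λ x h) =
      Λ x (adjoint (T (sumSemigroup.incl 𝒮 i c)) h) := by
  set e := sumSemigroup.incl 𝒮 i c
  have he : (e : Ω → ℝ) = Pi.single i (c : ℝ) := rfl
  -- In adjoint form the claim can be tested on the vectors $\Lambda_yg$, where it reads: the symbol
  -- at $y+e-x$ is $T_e$ times the symbol at $z=y-x$. As $x_i=0$, $z_i\ge0$; so $e$ only enlarges
  -- $z_+$, and $T_e$ commutes with $T_{z_-}^*$.
  have key : adjoint (Λ x) ∘L V e = T e ∘L adjoint (Λ x) := by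
    refine ext_of_total hV.total fun y g => ?_
    have hz := hS _ (sub_mem (AddSubgroup.subset_closure y.2) (AddSubgroup.subset_closure x.2))
    set z : Ω → ℝ := y - x
    have hzi : 0 ≤ z i := by simpa [z, hx] using hpos i _ (y.2.2 i)
    have hzm : z⁻ i = 0 := by simpa [Pi.negPart_apply] using hzi
    have hsum : (y + e : Ω → ℝ) - x = (z⁺ + e) - z⁻ := by
      rw [add_sub_right_comm, add_sub_right_comm, posPart_sub_negPart]
    have hce : (0 : Ω → ℝ) ≤ e := by
      rw [he]
      simpa using hpos i c c.2
    have hsym : regularSymbol T ((y + e : Ω → ℝ) - x) = T e * regularSymbol T z := by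
      rw [hsum, regularSymbol_sub_of_disjoint T (add_nonneg (posPart_nonneg z) hce)
        (negPart_nonneg z), add_comm, hT.extendByOne_add e.2 hz.1, ← mul_assoc,
        ← (hdc.commute_star hT e.2 hz.2 _).eq, mul_assoc, extendByOne_coe, regularSymbol]
      · intro j
        by_cases hj : j = i
        · subst hj
          exact Or.inr hzm
        · exact Or.inl (by simp [he, hj])
      · intro j
        by_cases hj : j = i
        · subst hj
          exact Or.inr hzm
        · rcases le_total 0 (z j) with h | h <;>
            simp [he, hj, Pi.posPart_apply, Pi.negPart_apply, h]
    have h1 := hV.gram x (y + e)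
    have h2 := hV.gram x y
    simp only [AddSubmonoid.coe_subtype, AddSubmonoid.coe_add, hsym] at h1 h2
    rw [comp_apply, comp_apply, hV.shift, AddMonoidHom.id_apply, ← comp_apply, h1,
      ← comp_apply (adjoint (Λ x)), h2]
    rfl
  have key' := congrArg adjoint key
  rw [adjoint_comp, adjoint_comp, adjoint_adjoint] at key'
  exact congrArg (fun A : H →L[ℂ] K => A h) key'

open Classical in
theorem sumSemigroup.incl_add (i : Ω) (c d : 𝒮 i) :
    sumSemigroup.incl 𝒮 i (c + d) = sumSemigroup.incl 𝒮 i c + sumSemigroup.incl 𝒮 i d :=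
  Subtype.ext (Pi.single_add (f := fun _ => ℝ) i c d)

open Classical in
theorem sumSemigroup.incl_zero (i : Ω) : sumSemigroup.incl 𝒮 i 0 = 0 :=
  Subtype.ext (Pi.single_zero (M := fun _ => ℝ) i)

/-- Splitting off the common part of `x` and `e_i(a)`. -/
theorem sumSemigroup.exists_split (hpos : ∀ i, ∀ x ∈ 𝒮 i, 0 ≤ x)
    (hcomm : ∀ i, IsCommensurable (𝒮 i)) (x : sumSemigroup 𝒮) {i : Ω} (a : 𝒮 i) :
    ∃ (y : sumSemigroup 𝒮) (c d : 𝒮 i), x = y + incl 𝒮 i d ∧ a = c + d ∧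
      (c = 0 ∨ (y : Ω → ℝ) i = 0) := by
  classical
  have hmem : ∀ {b : ℝ}, b ∈ 𝒮 i → (insert i ∅ : Set Ω)ᶜ.indicator (x : Ω → ℝ) + Pi.single i b ∈
      sumSemigroup 𝒮 := fun hb => add_mem (indicator_mem x.2 _) (single_mem hb)
  have hx : (x : Ω → ℝ) = (insert i ∅ : Set Ω)ᶜ.indicator (x : Ω → ℝ) +
      Pi.single i ((x : Ω → ℝ) i) := by
    conv_lhs => rw [← Set.indicator_compl_add_self (insert i ∅ : Set Ω) (x : Ω → ℝ),
      Set.indicator_insert_eq_single_add (by simp), Set.indicator_empty', add_zero]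
  -- The common part `d` is $\min(x_i,a)$; commensurability keeps the remainder in the semigroup.
  rcases le_total ((x : Ω → ℝ) i) a with h | h
  · have hc := (hcomm i).max_sub_mem (hpos i) a.2 (x.2.2 i)
    rw [max_eq_left (sub_nonneg.2 h)] at hc
    refine ⟨⟨_, hmem (𝒮 i).zero_mem⟩, ⟨_, hc⟩, ⟨_, x.2.2 i⟩, Subtype.ext ?_, Subtype.ext ?_,
      Or.inr ?_⟩
    · simpa [incl] using hx
    · simp
    · simp
  · have hc := (hcomm i).max_sub_mem (hpos i) (x.2.2 i) a.2
    rw [max_eq_left (sub_nonneg.2 h)] at hc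
    refine ⟨⟨_, hmem hc⟩, 0, a, Subtype.ext ?_, (zero_add a).symm, Or.inl rfl⟩
    simp only [incl, AddSubmonoid.coe_add]
    rw [add_assoc, ← Pi.single_add, sub_add_cancel]
    exact hx

/-- For $x=y+\mathbf e_i(d)$ and $a=c+d$, the formula `key` gives $V_{\mathbf
e_i(a)}^*\Lambda_x=\Lambda_yT_{\mathbf e_i(c)}^*$. It survives replacing $y$ by $y+\mathbf e_j(b)$,
since $j\ne i$ leaves $y_i$ unchanged. -/
theorem IsShiftDilation.doublyCommutes (hpos : ∀ i, ∀ x ∈ 𝒮 i, 0 ≤ x)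
    (hcomm : ∀ i, IsCommensurable (𝒮 i))
    {T : sumSemigroup 𝒮 → (H →L[ℂ] H)} (hT : IsOpSemigroup T) (hdc : DoublyCommutes T)
    {Λ : sumSemigroup 𝒮 → (H →L[ℂ] K)} {J : H →ₗᵢ[ℂ] K} {V : sumSemigroup 𝒮 → (K →L[ℂ] K)}
    (hV : IsShiftDilation (AddSubmonoid.subtype _) (AddMonoidHom.id _) T Λ J V) :
    DoublyCommutes V := by
  intro i j hij a b
  have hS := sumSemigroup_posNegClosed hpos hcomm
  have key : ∀ (y : sumSemigroup 𝒮) (c d : 𝒮 i), (c = 0 ∨ (y : Ω → ℝ) i = 0) → ∀ h : H,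
      adjoint (V (sumSemigroup.incl 𝒮 i (c + d))) (Λ (y + sumSemigroup.incl 𝒮 i d) h) =
        Λ y (adjoint (T (sumSemigroup.incl 𝒮 i c)) h) := by
    intro y c d hcy h
    rw [add_comm c d, sumSemigroup.incl_add, hV.isOpSemigroup.map_add, mul_def, adjoint_comp,
      comp_apply]
    rw [show adjoint (V (sumSemigroup.incl 𝒮 i d)) (Λ (y + sumSemigroup.incl 𝒮 i d) h) = Λ y h
      from hV.star_shift _ y h]
    rcases hcy with rfl | hy
    · rw [sumSemigroup.incl_zero, hV.isOpSemigroup.map_zero, hT.map_zero, ← star_eq_adjoint,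
        ← star_eq_adjoint, star_one, star_one]
      rfl
    · exact hV.adjoint_apply_of_apply_eq_zero hpos hS hT hdc c hy h
  refine ext_of_total hV.total fun x h => ?_
  obtain ⟨y, c, d, rfl, rfl, hcy⟩ := sumSemigroup.exists_split hpos hcomm x a
  rw [mul_def, mul_def, comp_apply, comp_apply, key y c d hcy, hV.shift, hV.shift,
    AddMonoidHom.id_apply, add_right_comm, key _ c d (hcy.imp_right fun hy => ?_)]
  simp [sumSemigroup.incl, hy, hij]

end Isometric

/-! ### Assembly. -/

theorem mainTheorem3 {Ω : Type u} (𝒮 : Ω → AddSubmonoid ℝ)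
    (hpos : ∀ i, ∀ x ∈ 𝒮 i, 0 ≤ x) (hcomm : ∀ i, IsCommensurable (𝒮 i))
    {H : Type v} [NormedAddCommGroup H] [InnerProductSpace ℂ H] [CompleteSpace H]
    (T : sumSemigroup 𝒮 → (H →L[ℂ] H)) (hT : IsContractiveSemigroup T) (hdc : DoublyCommutes T) :
    (∃ (K : Type (max u v)) (_ : NormedAddCommGroup K) (_ : InnerProductSpace ℂ K)
        (_ : CompleteSpace K) (J : H →ₗᵢ[ℂ] K) (U : sumSemigroup 𝒮 → (K →L[ℂ] K)),
      IsMinimalRegularUnitaryDilation (sumSemigroup_posNegClosed hpos hcomm) T J U ∧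
      DoublyCommutes U ∧
      ∀ (K' : Type w) [NormedAddCommGroup K'] [InnerProductSpace ℂ K'] [CompleteSpace K']
        (J' : H →ₗᵢ[ℂ] K') (U' : sumSemigroup 𝒮 → (K' →L[ℂ] K')),
        IsMinimalRegularUnitaryDilation (sumSemigroup_posNegClosed hpos hcomm) T J' U' →
        DilationEquivalent J U J' U') ∧
    (∃ (K : Type (max u v)) (_ : NormedAddCommGroup K) (_ : InnerProductSpace ℂ K)
        (_ : CompleteSpace K) (J : H →ₗᵢ[ℂ] K) (V : sumSemigroup 𝒮 → (K →L[ℂ] K)),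
      IsMinimalRegularIsometricDilation (sumSemigroup_posNegClosed hpos hcomm) T J V ∧
      DoublyCommutes V ∧
      ∀ (K' : Type w) [NormedAddCommGroup K'] [InnerProductSpace ℂ K'] [CompleteSpace K']
        (J' : H →ₗᵢ[ℂ] K') (V' : sumSemigroup 𝒮 → (K' →L[ℂ] K')),
        IsMinimalRegularIsometricDilation (sumSemigroup_posNegClosed hpos hcomm) T J' V' →
        DilationEquivalent J V J' V') := by
  constructor
  · obtain ⟨K, _, _, _, Λ, J, U, hU⟩ := exists_isShiftDilation hpos hcomm hT hdc
      (AddSubgroup.subtype _) (inclClosure (sumSemigroup 𝒮)) (fun x => x.2) (fun _ => rfl)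
    have hmin := hU.isMinimalRegularUnitaryDilation (hS := sumSemigroup_posNegClosed hpos hcomm)
    exact ⟨K, inferInstance, inferInstance, inferInstance, J, U, hmin,
      .of_unitary hmin.semigroup hmin.unitary,
      fun K' _ _ _ J' U' hU' => hU.dilationEquivalent_unitary hU'⟩
  · obtain ⟨K, _, _, _, Λ, J, V, hV⟩ := exists_isShiftDilation hpos hcomm hT hdc
      (AddSubmonoid.subtype _) (AddMonoidHom.id (sumSemigroup 𝒮))
      (fun x => AddSubgroup.subset_closure x.2) (fun _ => rfl)
    exact ⟨K, inferInstance, inferInstance, inferInstance, J, V,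
      hV.isMinimalRegularIsometricDilation,
      hV.doublyCommutes hpos hcomm hT.toIsOpSemigroup hdc,
      fun K' _ _ _ J' V' hV' => hV.dilationEquivalent_isometric hV'⟩
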